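/- Let $\mathbf{F}_q$ be a finite field with $q$ elements, and let $X\subset\mathbf{P}^3$ be an elliptic quadric over $\mathbf{F}_q$, i.e. a quadric surface projectively equivalent over $\mathbf{F}_q$ to $f(x_0,x_1)+x_2x_3=0$, where $f$ is a binary quadratic form irreducible over $\mathbf{F}_q$. A quadric surface means the closed subscheme of $\mathbf{P}^3$ defined by a nonzero quadratic form over $\mathbf{F}_q$ (possibly singular, reducible or non-reduced). (1) If $X'$ is a quadric surface over $\mathbf{F}_q$ distinct from $X$, then $\sharp (X\cap X')(\mathbf{F}_q)\le 2q+2$. (2) If $q\ge 3$, this bound is reached: there is a quadric surface $X'\neq X$ over $\mathbf{F}_q$ with $\sharp (X\cap X')(\mathbf{F}_q)=2q+2$. (3) If $q\ge 3$, let $C_L(X,\mathcal{O}_X(2))\subseteq \mathbf{F}_q^{X(\mathbf{F}_q)}$ be the image of the map that evaluates the elements of $H^0(X,\mathcal{O}_X(2))$ (quadratic forms in four variables modulo multiples of the equation of $X$) at all rational points of $X$, for any choice of coordinates on the fibres of $\mathcal{O}_X(2)$ at these points. Then this code has parameters $[q^2+1,\,9,\,q^2-2q-1]$: its length is $q^2+1$,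 its dimension is $9$ and its minimum Hamming distance is exactly $q^2-2q-1$. -/

import Mathlib

noncomputable section

namespace EllipticQuadric

open MvPolynomial
open scoped LinearAlgebra.Projectivization

variable {K : Type*} [Field K]

/-- The form `F` defines a quadric surface in `ℙ³` over `K`
(possibly singular, reducible or non-reduced). -/
def IsQuadricForm (F : MvPolynomial (Fin 4) K) : Prop :=
  F.IsHomogeneous 2 ∧ F ≠ 0

/-- The substitution `xᵢ ↦ ∑ⱼ Aᵢⱼ xⱼ` in a polynomial in four variables. -/
def linearSubst (A : GL (Fin 4) K) (F : MvPolynomial (Fin 4) K) : MvPolynomial (Fin 4) K :=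
  bind₁ (fun i => ∑ j, C ((A : Matrix (Fin 4) (Fin 4) K) i j) * X j) F

/-- `F = 0` is an elliptic quadric: it is projectively equivalent to
`f(x₀, x₁) + x₂ x₃ = 0`, where `f` is a binary quadratic form that is irreducible over `K`. -/
def IsElliptic (F : MvPolynomial (Fin 4) K) : Prop :=
  ∃ f : MvPolynomial (Fin 2) K, f.IsHomogeneous 2 ∧ Irreducible f ∧
    ∃ A : GL (Fin 4) K, F = linearSubst A (rename ![0, 1] f + X 2 * X 3)

/-- The set of `K`-rational points of the surface `F = 0` in `ℙ³`. -/
def rationalPoints (F : MvPolynomial (Fin 4) K) : Set (ℙ K (Fin 4 → K)) :=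
  {P | ∀ v ∈ P.submodule, eval v F = 0}

theorem eval_rep_eq_zero {F : MvPolynomial (Fin 4) K} {P : ℙ K (Fin 4 → K)}
    (hP : P ∈ rationalPoints F) : eval P.rep F = 0 :=
  hP _ (by
    rw [Projectivization.submodule_eq]
    exact Submodule.mem_span_singleton_self _)

/-- The forms of degree `m` that are multiples of `F`. -/
def vanishingForms (F : MvPolynomial (Fin 4) K) (m : ℕ) :
    Submodule K (homogeneousSubmodule (Fin 4) K m) :=
  ((Ideal.span {F}).restrictScalars K).comap (homogeneousSubmodule (Fin 4) K m).subtype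

/-- `H⁰(X, 𝒪_X(m))` for the surface `X : F = 0`: the restrictions to `X` of the forms of
degree `m`, that is, the forms of degree `m` modulo the multiples of `F`. -/
abbrev GlobalSections (F : MvPolynomial (Fin 4) K) (m : ℕ) : Type _ :=
  homogeneousSubmodule (Fin 4) K m ⧸ vanishingForms F m

/-- Evaluation of forms of degree `m` at the rational points of `F = 0`. The fibre of `𝒪(m)` at
`P` is a line, on which `s ↦ s(P.rep)` is a coordinate; every other coordinate on
it is a multiple of this one by a nonzero scalar `l P`. -/
def evalForms (F : MvPolynomial (Fin 4) K) (m : ℕ) (l : rationalPoints F → Kˣ) :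
    homogeneousSubmodule (Fin 4) K m →ₗ[K] (rationalPoints F → K) where
  toFun s := fun P => (l P : K) * eval P.1.rep s.1
  map_add' s t := by
    funext P
    simp [mul_add]
  map_smul' a s := by
    funext P
    simp only [SetLike.val_smul, smul_eval, RingHom.id_apply, Pi.smul_apply, smul_eq_mul]
    ring

theorem vanishingForms_le_ker (F : MvPolynomial (Fin 4) K) (m : ℕ)
    (l : rationalPoints F → Kˣ) : vanishingForms F m ≤ LinearMap.ker (evalForms F m l) := by
  intro s hs
  obtain ⟨h, hh⟩ := Ideal.mem_span_singleton'.mp (show s.1 ∈ Ideal.span {F} from hs)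
  rw [LinearMap.mem_ker]
  funext P
  change (l P : K) * eval P.1.rep s.1 = 0
  rw [← hh, map_mul, eval_rep_eq_zero P.2, mul_zero, mul_zero]

/-- The evaluation map `H⁰(X, 𝒪_X(m)) → ⨁ 𝒪_X(m)_P ≃ K ^ X(K)`, for the coordinates on the fibres
given by `l`. -/
def evalSections (F : MvPolynomial (Fin 4) K) (m : ℕ) (l : rationalPoints F → Kˣ) :
    GlobalSections F m →ₗ[K] (rationalPoints F → K) :=
  (vanishingForms F m).liftQ (evalForms F m l) (vanishingForms_le_ker F m l)

/-- The code `C_L(X, 𝒪_X(m))` of the surface `X : F = 0`, for the coordinates on the fibres given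
by `l`. -/
def functionalCode (F : MvPolynomial (Fin 4) K) (m : ℕ) (l : rationalPoints F → Kˣ) :
    Submodule K (rationalPoints F → K) :=
  LinearMap.range (evalSections F m l)

open Classical in
/-- A linear code `C ⊆ K ^ ι` has parameters `[n, k, d]`: length `n`, dimension `k`, and minimum
Hamming distance between distinct codewords exactly `d`. -/
def HasParameters {ι : Type*} [Fintype ι] (C : Submodule K (ι → K)) (n k d : ℕ) : Prop :=
  Fintype.card ι = n ∧ Module.finrank K C = k ∧
    IsLeast {e : ℕ | ∃ x ∈ C, ∃ y ∈ C, x ≠ y ∧ hammingDist x y = e} d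

instance rationalPointsFintype [Finite K] (F : MvPolynomial (Fin 4) K) : Fintype (rationalPoints F) :=
  Fintype.ofFinite _

end EllipticQuadric

end

/-! In coordinates where `X` is `f(x₀, x₁) + x₂ x₃ = 0`, the form `f` has no nontrivial zero over
`K`, so `(0 : 0 : 1 : 0)` is the only rational point of `X` with `x₃ = 0`; the others are `(x : y :
-f(x, y) : 1)`. Over an extension, `f = a z z^q` with `z = x - y α`
(`IsAnisotropic.exists_conjugate`). A quadratic form restricted to this chart thus becomes a
polynomial in `z` and `w = z^q` of degree at most 2 in each, nonzero unless the form is a multiple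
of the equation of `X`. For `q ≥ 3` the nine exponents `i + j q` are distinct, so at most `2 q + 2`
values of `z` are zeros. The coefficient of `z^(2q+2)` vanishes when `X'` contains the point at
infinity, which compensates for that extra point (`IsAnisotropic.card_zeros_le`). For `q = 2` the
bound exceeds `q² + 1`.

Equality comes from two planes cutting the disjoint conics `f = s` and `f = t`, each with `q + 1`
points (`IsAnisotropic.card_fiber`). Since `q² + 1 > 2 q + 2` for `q ≥ 3`, only multiples of the
equation of `X` evaluate to zero, so the dimension is `10 - 1`; the minimum distance is `q² + 1 - (2
q + 2)`. -/

noncomputable section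

namespace EllipticQuadric

open MvPolynomial
open scoped LinearAlgebra.Projectivization

universe u

/-! ### Anisotropic binary quadratic forms and their factorization over an extension -/

section BinaryForms

variable {K : Type*} [Field K]

/-- The value at `(x, y)` of the binary quadratic form with coefficients `a`, `b`, `c`. -/
def binaryVal (a b c x y : K) : K := a * x ^ 2 + b * (x * y) + c * y ^ 2

/-- The binary quadratic form with coefficients `a`, `b`, `c` has no nontrivial zero. -/
def IsAnisotropic (a b c : K) : Prop := ∀ x y : K, binaryVal a b c x y = 0 → x = 0 ∧ y = 0

theorem IsAnisotropic.ne_zero {a b c : K} (h : IsAnisotropic a b c) : a ≠ 0 := by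
  rintro rfl
  exact one_ne_zero (h 1 0 (by simp [binaryVal])).1

theorem mem_of_isHomogeneous_two {σ : Type*} {S : Submodule K (MvPolynomial σ K)}
    (hS : ∀ i j, X i * X j ∈ S) {F : MvPolynomial σ K} (hF : F.IsHomogeneous 2) : F ∈ S := by
  rw [F.as_sum]
  refine Submodule.sum_mem _ fun d hd => ?_
  have hdeg : d.degree = 2 := by
    rw [Finsupp.degree_eq_weight_one]
    exact hF (mem_support_iff.mp hd)
  have split : ∀ e : σ →₀ ℕ, e.degree ≠ 0 → ∃ i e', e = Finsupp.single i 1 + e' := by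
    intro e he
    obtain ⟨i, hi⟩ := Finsupp.ne_iff.mp fun h : e = 0 => he (by simp [h])
    exact ⟨i, e - Finsupp.single i 1, (add_tsub_cancel_of_le
      (Finsupp.single_le_iff.mpr (Nat.one_le_iff_ne_zero.mpr hi))).symm⟩
  obtain ⟨i, e, rfl⟩ := split d (by omega)
  simp only [map_add, Finsupp.degree_single] at hdeg
  obtain ⟨j, e, rfl⟩ := split e (by omega)
  simp only [map_add, Finsupp.degree_single] at hdeg
  obtain rfl : e = 0 := (Finsupp.degree_eq_zero_iff e).mp (by omega)
  rw [add_zero]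
  have : monomial (Finsupp.single i 1 + Finsupp.single j 1)
      (coeff (Finsupp.single i 1 + Finsupp.single j 1) F)
      = coeff (Finsupp.single i 1 + Finsupp.single j 1) F • (X i * X j) := by
    simp [X, monomial_mul, smul_monomial]
  rw [this]
  exact S.smul_mem _ (hS i j)

theorem exists_coeff_of_isHomogeneous_two {f : MvPolynomial (Fin 2) K}
    (hf : f.IsHomogeneous 2) :
    ∃ a b c : K, f = C a * X 0 ^ 2 + C b * (X 0 * X 1) + C c * X 1 ^ 2 := by
  have hmem : f ∈ Submodule.span K {X 0 ^ 2, X 0 * X 1, X 1 ^ 2} := by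
    refine mem_of_isHomogeneous_two (fun i j => Submodule.subset_span ?_) hf
    fin_cases i <;> fin_cases j <;> simp [sq, mul_comm]
  obtain ⟨a, b, c, h⟩ := Submodule.mem_span_triple.mp hmem
  exact ⟨a, b, c, by simp only [← h, smul_eq_C_mul]⟩

/-- A nontrivial zero splits off a linear factor. Both factors vanish at the origin, so neither is a
unit. -/
theorem isAnisotropic_of_irreducible {a b c : K}
    (h : Irreducible (C a * X 0 ^ 2 + C b * (X 0 * X 1) + C c * X 1 ^ 2 :
      MvPolynomial (Fin 2) K)) : IsAnisotropic a b c := by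
  have nonunit : ∀ p : MvPolynomial (Fin 2) K, eval 0 p = 0 → ¬ IsUnit p := by
    intro p hp hu
    exact (hu.map (eval (0 : Fin 2 → K))).ne_zero hp
  have key : ∀ p p' : MvPolynomial (Fin 2) K, eval 0 p = 0 → eval 0 p' = 0 →
      (C a * X 0 ^ 2 + C b * (X 0 * X 1) + C c * X 1 ^ 2 : MvPolynomial (Fin 2) K) ≠ p * p' :=
    fun p p' hp hp' he => (h.isUnit_or_isUnit he).elim (nonunit p hp) (nonunit p' hp')
  intro x y hxy
  unfold binaryVal at hxy
  by_cases hy : y = 0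
  · subst hy
    refine ⟨?_, rfl⟩
    by_contra hx
    have ha : a = 0 := by
      have : a * x ^ 2 = 0 := by linear_combination hxy
      exact (mul_eq_zero.mp this).resolve_right (pow_ne_zero 2 hx)
    subst ha
    exact key (X 1) (C b * X 0 + C c * X 1) (by simp) (by simp) (by simp; ring)
  · exfalso
    have hc : c = -(a * (x / y) ^ 2 + b * (x / y)) := by
      field_simp
      linear_combination hxy
    refine key (X 0 - C (x / y) * X 1) (C a * X 0 + C (b + a * (x / y)) * X 1)
      (by simp) (by simp) ?_
    rw [hc]
    simp only [map_add, map_neg, map_mul, map_pow]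
    ring

/-- Over a finite field with `q` elements, an anisotropic binary quadratic form is
`a * z ^ (q + 1)`, where `z` is a linear form over an extension field. -/
theorem IsAnisotropic.exists_conjugate {K : Type u} [Field K] [Fintype K] {a b c : K}
    (h : IsAnisotropic a b c) :
    ∃ (L : Type u) (_ : Field L) (_ : Algebra K L) (α β : L),
      (∀ x y : K, algebraMap K L x + algebraMap K L y * α = 0 → x = 0 ∧ y = 0) ∧ α ≠ β ∧
      (∀ x y : K, (algebraMap K L x - algebraMap K L y * α) ^ Fintype.card K
        = algebraMap K L x - algebraMap K L y * β) ∧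
      algebraMap K L a * (α + β) + algebraMap K L b = 0 ∧
      algebraMap K L a * (α * β) = algebraMap K L c := by
  have ha := h.ne_zero
  let L := AlgebraicClosure K
  obtain ⟨α, hα⟩ := IsAlgClosed.exists_aeval_eq_zero (R := K) L
    (Polynomial.C a * Polynomial.X ^ 2 + Polynomial.C b * Polynomial.X + Polynomial.C c)
    (by rw [Polynomial.degree_quadratic ha]; decide)
  simp only [map_add, map_mul, map_pow, Polynomial.aeval_X, Polynomial.aeval_C] at hα
  classical
  have hinj := (algebraMap K L).injective
  have hαK : ∀ r : K, algebraMap K L r ≠ α := by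
    rintro r rfl
    have : a * r ^ 2 + b * r + c = 0 := hinj (by simpa using hα)
    exact one_ne_zero (h r 1 (by unfold binaryVal; linear_combination this)).2
  let φ : L →ₐ[K] L := FiniteField.frobeniusAlgHom K L
  have hφ : ∀ z, φ z = z ^ Fintype.card K := fun z => by simp [φ]
  -- Otherwise `X ^ q - X` would have `q + 1` roots: the `q` elements of `K` together with `α`.
  have hne : α ≠ φ α := by
    intro he
    rw [hφ] at he
    have hq := Fintype.one_lt_card (α := K)
    have hp := FiniteField.X_pow_card_sub_X_ne_zero L hq
    have hle := Polynomial.card_le_degree_of_subset_roots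
      (Z := (insert α (Finset.univ.map ⟨algebraMap K L, hinj⟩ : Finset L)))
      (p := (Polynomial.X ^ Fintype.card K - Polynomial.X : Polynomial L)) (by
        intro z hz
        rw [Finset.mem_val, Finset.mem_insert] at hz
        rw [Polynomial.mem_roots hp]
        rcases hz with rfl | hz
        · simp [← he]
        · obtain ⟨r, -, rfl⟩ := Finset.mem_map.mp hz
          simp [← map_pow, FiniteField.pow_card])
    rw [Finset.card_insert_of_notMem (by simpa using hαK), Finset.card_map, Finset.card_univ,
      FiniteField.X_pow_card_sub_X_natDegree_eq L hq] at hle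
    omega
  refine ⟨L, inferInstance, inferInstance, α, φ α, ?_, hne, ?_, ?_⟩
  · intro x y hxy
    have hy : y = 0 := by
      by_contra hy
      apply hαK (-x / y)
      rw [map_div₀, div_eq_iff (by simpa using hy), map_neg]
      linear_combination -hxy
    subst hy
    exact ⟨hinj (by simpa using hxy), rfl⟩
  · intro x y
    rw [← hφ]
    simp
  · have hβ := congrArg φ hα
    simp only [map_add, map_mul, map_pow, AlgHom.commutes, map_zero] at hβ
    have h1 : algebraMap K L a * (α + φ α) + algebraMap K L b = 0 :=
      mul_left_cancel₀ (sub_ne_zero.mpr hne) (by linear_combination hα - hβ)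
    exact ⟨h1, by linear_combination α * h1 - hα⟩

end BinaryForms

/-! ### Counting zeros in the affine chart -/

section Counting

/-- A nonzero polynomial in `z` and `w` of degree at most two in each variable becomes after the
substitution `w = z ^ q` a polynomial with at most `2 q + 2` zeros. -/
theorem card_zeros_add_le {L : Type*} [Field L] {q : ℕ} (hq : 3 ≤ q) (e : Fin 9 → L)
    (he : e ≠ 0) (Z : Finset L)
    (hZ : ∀ z ∈ Z, e 0 + e 1 * z + e 2 * z ^ 2 + e 3 * z ^ q + e 4 * (z * z ^ q)
      + e 5 * (z ^ 2 * z ^ q) + e 6 * (z ^ q) ^ 2 + e 7 * (z * (z ^ q) ^ 2)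
      + e 8 * (z ^ 2 * (z ^ q) ^ 2) = 0) :
    Z.card ≤ 2 * q + 2 ∧ (e 8 = 0 → Z.card ≤ 2 * q + 1) := by
  let n : Fin 9 → ℕ := ![0, 1, 2, q, q + 1, q + 2, 2 * q, 2 * q + 1, 2 * q + 2]
  let p : Polynomial L := ∑ i, Polynomial.C (e i) * Polynomial.X ^ n i
  -- This is where `q ≥ 3` is needed: for `q = 2` the monomials `z ^ 2` and `z ^ q` coincide.
  have hn : Function.Injective n := by
    intro i j hij
    fin_cases i <;> fin_cases j <;> simp [n] at hij ⊢ <;> omega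
  have hcoeff : ∀ i, p.coeff (n i) = e i := by
    intro i
    simp [p, Polynomial.coeff_C_mul, Polynomial.coeff_X_pow, hn.eq_iff]
  have hp : p ≠ 0 := by
    intro h
    apply he
    funext i
    rw [← hcoeff i, h, Polynomial.coeff_zero, Pi.zero_apply]
  have hcard : Z.card ≤ p.natDegree := by
    apply Polynomial.card_le_degree_of_subset_roots
    intro z hz
    rw [Polynomial.mem_roots hp, Polynomial.IsRoot.def, ← hZ z hz]
    simp only [p, n, Fin.sum_univ_succ, Polynomial.eval_add, Polynomial.eval_mul,
      Polynomial.eval_C, Polynomial.eval_pow, Polynomial.eval_X]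
    simp
    ring
  refine ⟨hcard.trans ?_, fun h8 => hcard.trans ?_⟩
  · refine Polynomial.natDegree_sum_le_of_forall_le _ _ fun i _ => ?_
    refine (Polynomial.natDegree_C_mul_X_pow_le _ _).trans ?_
    fin_cases i <;> simp [n] <;> omega
  · refine Polynomial.natDegree_sum_le_of_forall_le _ _ fun i _ => ?_
    by_cases hi : i = 8
    · simp [hi, h8]
    · refine (Polynomial.natDegree_C_mul_X_pow_le _ _).trans ?_
      fin_cases i <;> simp [n] at hi ⊢ <;> omega

variable {K : Type u} [Field K]

theorem injective_sub_mul {L : Type*} [Field L] [Algebra K L] {α : L}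
    (hα : ∀ x y : K, algebraMap K L x + algebraMap K L y * α = 0 → x = 0 ∧ y = 0) :
    Function.Injective fun p : K × K => algebraMap K L p.1 - algebraMap K L p.2 * α := by
  rintro ⟨x, y⟩ ⟨x', y'⟩ h
  have := hα (x - x') (y' - y) (by
    simp only [map_sub]
    linear_combination h)
  rw [Prod.mk.injEq]
  exact ⟨sub_eq_zero.mp this.1, (sub_eq_zero.mp this.2).symm⟩

open Classical in
/-- An anisotropic binary quadratic form over a finite field with `q` elements takes every nonzero
value exactly `q + 1` times. -/
theorem IsAnisotropic.card_fiber [Fintype K] {a b c : K} (h : IsAnisotropic a b c) {s : K}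
    (hs : s ≠ 0) :
    (Finset.univ.filter fun p : K × K => binaryVal a b c p.1 p.2 = s).card
      = Fintype.card K + 1 := by
  set q := Fintype.card K with hqdef
  have hq1 : 1 < q := Fintype.one_lt_card
  -- The value is `a * z ^ (q + 1)`, and `z ^ (q + 1) = t / a` has at most `q + 1` solutions. The `q
  -- - 1` nonzero fibres together contain `q ^ 2 - 1` pairs, so each of these bounds is attained.
  have hle : ∀ t : K, t ≠ 0 →
      (Finset.univ.filter fun p : K × K => binaryVal a b c p.1 p.2 = t).card ≤ q + 1 := by
    intro t ht
    obtain ⟨L, _, _, α, β, hα, hne, hconj, h1, h2⟩ := h.exists_conjugate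
    have ha : algebraMap K L a ≠ 0 := by simpa using h.ne_zero
    rw [← Finset.card_image_of_injective _ (injective_sub_mul hα)]
    refine le_trans (Finset.card_le_card (t := (Polynomial.nthRoots (q + 1)
      (algebraMap K L t / algebraMap K L a)).toFinset) ?_)
      ((Multiset.toFinset_card_le _).trans (Polynomial.card_nthRoots _ _))
    intro z hz
    obtain ⟨⟨x, y⟩, hp, rfl⟩ := Finset.mem_image.mp hz
    rw [Multiset.mem_toFinset, Polynomial.mem_nthRoots q.succ_pos, eq_div_iff ha, pow_succ, hconj,
      ← (Finset.mem_filter.mp hp).2]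
    simp only [binaryVal, map_add, map_mul, map_pow]
    linear_combination (-algebraMap K L x * algebraMap K L y) * h1 + (algebraMap K L y) ^ 2 * h2
  have hzero : (Finset.univ.filter fun p : K × K => binaryVal a b c p.1 p.2 = 0).card = 1 := by
    rw [Finset.card_eq_one]
    refine ⟨(0, 0), ?_⟩
    ext ⟨x, y⟩
    simp only [Finset.mem_filter, Finset.mem_univ, true_and, Finset.mem_singleton, Prod.mk.injEq]
    refine ⟨h x y, ?_⟩
    rintro ⟨rfl, rfl⟩
    simp [binaryVal]
  have hsum := Finset.card_eq_sum_card_fiberwise (s := (Finset.univ : Finset (K × K)))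
    (t := (Finset.univ : Finset K)) (f := fun p => binaryVal a b c p.1 p.2) (fun _ _ => by simp)
  rw [← Finset.add_sum_erase _ _ (Finset.mem_univ (0 : K)), hzero,
    ← Finset.add_sum_erase _ _ (Finset.mem_erase.mpr ⟨hs, Finset.mem_univ s⟩), Finset.card_univ,
    Fintype.card_prod, ← hqdef] at hsum
  have hrest : ∑ t ∈ (Finset.univ.erase (0 : K)).erase s,
      (Finset.univ.filter fun p : K × K => binaryVal a b c p.1 p.2 = t).card
        ≤ (q - 2) * (q + 1) := by
    refine (Finset.sum_le_card_nsmul _ _ (q + 1) fun t ht => hle t ?_).trans (le_of_eq ?_)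
    · exact (Finset.mem_erase.mp (Finset.mem_erase.mp ht).2).1
    · rw [Finset.card_erase_of_mem (Finset.mem_erase.mpr ⟨hs, Finset.mem_univ s⟩),
        Finset.card_erase_of_mem (Finset.mem_univ _), Finset.card_univ, smul_eq_mul, ← hqdef,
        Nat.sub_sub]
  refine le_antisymm (hle s hs) ?_
  obtain ⟨r, hr⟩ : ∃ r, q = r + 2 := ⟨q - 2, by omega⟩
  rw [hr] at hsum hrest ⊢
  rw [Nat.add_sub_cancel] at hrest
  nlinarith

/-- The value of the quadratic form in four variables with coefficients `d`. -/
def quadVal (d : Fin 10 → K) (v : Fin 4 → K) : K :=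
  d 0 * v 0 ^ 2 + d 1 * (v 0 * v 1) + d 2 * v 1 ^ 2 + d 3 * (v 0 * v 2) + d 4 * (v 0 * v 3)
    + d 5 * (v 1 * v 2) + d 6 * (v 1 * v 3) + d 7 * v 2 ^ 2 + d 8 * (v 2 * v 3) + d 9 * v 3 ^ 2

/-- The coefficients of the form `a x₀² + b x₀ x₁ + c x₁² + x₂ x₃`. -/
def ellipticCoeff (a b c : K) : Fin 10 → K := ![a, b, c, 0, 0, 0, 0, 0, 1, 0]

theorem quadVal_vecCons (d : Fin 10 → K) (x y u v : K) :
    quadVal d ![x, y, u, v] = d 0 * x ^ 2 + d 1 * (x * y) + d 2 * y ^ 2 + d 3 * (x * u)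
      + d 4 * (x * v) + d 5 * (y * u) + d 6 * (y * v) + d 7 * u ^ 2 + d 8 * (u * v)
      + d 9 * v ^ 2 := rfl

/-- The coefficient of `x₂ x₃` in the elliptic form is 1, so `d 8` is the only possible factor of
proportionality. -/
theorem eq_smul_ellipticCoeff {a b c : K} {d : Fin 10 → K} (h0 : d 0 = d 8 * a)
    (h1 : d 1 = d 8 * b) (h2 : d 2 = d 8 * c) (h3 : d 3 = 0) (h4 : d 4 = 0) (h5 : d 5 = 0)
    (h6 : d 6 = 0) (h7 : d 7 = 0) (h9 : d 9 = 0) : d = d 8 • ellipticCoeff a b c := by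
  funext i
  fin_cases i <;> simp [ellipticCoeff, *]

open Classical in
/-- A quadratic form that is not a multiple of `f(x₀, x₁) + x₂ x₃` has at most `2 q + 2` zeros
on this quadric, counted here in the affine chart `x₃ = 1` and at the remaining point
`(0 : 0 : 1 : 0)`. -/
theorem IsAnisotropic.card_zeros_le [Fintype K] (hq : 3 ≤ Fintype.card K) {a b c : K}
    (h : IsAnisotropic a b c) {d : Fin 10 → K} (hd : d ≠ d 8 • ellipticCoeff a b c) :
    (Finset.univ.filter fun p : K × K =>
      quadVal d ![p.1, p.2, -binaryVal a b c p.1 p.2, 1] = 0).card ≤ 2 * Fintype.card K + 2 ∧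
    (d 7 = 0 → (Finset.univ.filter fun p : K × K =>
      quadVal d ![p.1, p.2, -binaryVal a b c p.1 p.2, 1] = 0).card ≤ 2 * Fintype.card K + 1) := by
  obtain ⟨L, _, _, α, β, hα, hne, hconj, h1, h2⟩ := h.exists_conjugate
  have ha := h.ne_zero
  have hinj := (algebraMap K L).injective
  set ι := algebraMap K L
  have ha' : ι a ≠ 0 := by simpa using ha
  have hδ : β - α ≠ 0 := sub_ne_zero.mpr hne.symm
  -- Obtained by substituting `x = (β z - α w) / (β - α)`, `y = (z - w) / (β - α)` and `x₂ = -a z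
  -- w`, then multiplying by `(β - α) ^ 2`. Entry `i + 3 j` is the coefficient of `z ^ i * w ^ j`.
  let e : Fin 9 → L := ![(β - α) ^ 2 * ι (d 9), (β - α) * (ι (d 4) * β + ι (d 6)),
    ι (d 0) * β ^ 2 + ι (d 1) * β + ι (d 2), -(β - α) * (ι (d 4) * α + ι (d 6)),
    -(2 * α * β * ι (d 0)) - ι (d 1) * (α + β) - 2 * ι (d 2) - (β - α) ^ 2 * ι (d 8) * ι a,
    -ι a * (β - α) * (ι (d 3) * β + ι (d 5)), ι (d 0) * α ^ 2 + ι (d 1) * α + ι (d 2),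
    ι a * (β - α) * (ι (d 3) * α + ι (d 5)), (β - α) ^ 2 * ι a ^ 2 * ι (d 7)]
  have he : e ≠ 0 := by
    -- Entries 1, 2 and 5 are entries 3, 6 and 7 with `α` and `β` exchanged, so they are not needed.
    -- Linear independence of `1` and `α` over `K` splits each of the latter into two equations over
    -- `K`.
    intro he
    apply hd
    have e0 : (β - α) ^ 2 * ι (d 9) = 0 := congrFun he 0
    have e3 : -(β - α) * (ι (d 4) * α + ι (d 6)) = 0 := congrFun he 3
    have e4 : -(2 * α * β * ι (d 0)) - ι (d 1) * (α + β) - 2 * ι (d 2)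
      - (β - α) ^ 2 * ι (d 8) * ι a = 0 := congrFun he 4
    have e6 : ι (d 0) * α ^ 2 + ι (d 1) * α + ι (d 2) = 0 := congrFun he 6
    have e7 : ι a * (β - α) * (ι (d 3) * α + ι (d 5)) = 0 := congrFun he 7
    have e8 : (β - α) ^ 2 * ι a ^ 2 * ι (d 7) = 0 := congrFun he 8
    have d9 : d 9 = 0 := by simpa [hδ] using e0
    have d7 : d 7 = 0 := by simpa [hδ, ha] using e8
    obtain ⟨d6, d4⟩ := hα (d 6) (d 4) (by
      have := (mul_eq_zero.mp e3).resolve_left (neg_ne_zero.mpr hδ)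
      linear_combination this)
    obtain ⟨d5, d3⟩ := hα (d 5) (d 3) (by
      have := (mul_eq_zero.mp e7).resolve_left (mul_ne_zero ha' hδ)
      linear_combination this)
    -- `α` is a root of both `d 0 T² + d 1 T + d 2` and `a T² + b T + c`; eliminating `T²` shows
    -- that they are proportional.
    obtain ⟨d2, d1⟩ := hα (a * d 2 - d 0 * c) (a * d 1 - d 0 * b) (by
      simp only [map_sub, map_mul]
      linear_combination ι a * e6 - ι (d 0) * α * h1 + ι (d 0) * h2)
    have d1' := congrArg ι d1
    have d2' := congrArg ι d2
    simp only [map_sub, map_mul, map_zero] at d1' d2'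
    have d0 : d 0 = a * d 8 := by
      apply hinj
      have : (β - α) ^ 2 * ι a * (ι (d 0) - ι a * ι (d 8)) = 0 := by
        linear_combination ι a * e4 + (α + β) * d1' + 2 * d2' + ι (d 0) * (α + β) * h1
          - 2 * ι (d 0) * h2
      have := (mul_eq_zero.mp this).resolve_left (mul_ne_zero (pow_ne_zero 2 hδ) ha')
      rw [map_mul]
      linear_combination this
    have d1'' : d 1 = d 8 * b := mul_left_cancel₀ ha (by linear_combination d1 + b * d0)
    have d2'' : d 2 = d 8 * c := mul_left_cancel₀ ha (by linear_combination d2 + c * d0)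
    exact eq_smul_ellipticCoeff (by rw [d0, mul_comm]) d1'' d2'' d3 d4 d5 d6 d7 d9
  have key := card_zeros_add_le hq e he ((Finset.univ.filter fun p : K × K =>
      quadVal d ![p.1, p.2, -binaryVal a b c p.1 p.2, 1] = 0).image
        fun p : K × K => ι p.1 - ι p.2 * α) (by
    intro z hz
    obtain ⟨⟨x, y⟩, hp, rfl⟩ := Finset.mem_image.mp hz
    have hp := congrArg ι (Finset.mem_filter.mp hp).2
    rw [hconj]
    have hf : ι (binaryVal a b c x y) = ι a * ((ι x - ι y * α) * (ι x - ι y * β)) := by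
      simp only [binaryVal, map_add, map_mul, map_pow]
      linear_combination ι x * ι y * h1 - (ι y) ^ 2 * h2
    rw [quadVal_vecCons] at hp
    simp only [map_add, map_mul, map_pow, map_neg, map_one, map_zero, hf] at hp
    change (β - α) ^ 2 * ι (d 9) + (β - α) * (ι (d 4) * β + ι (d 6)) * _
      + (ι (d 0) * β ^ 2 + ι (d 1) * β + ι (d 2)) * _ + -(β - α) * (ι (d 4) * α + ι (d 6)) * _
      + (-(2 * α * β * ι (d 0)) - ι (d 1) * (α + β) - 2 * ι (d 2)
        - (β - α) ^ 2 * ι (d 8) * ι a) * _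
      + -ι a * (β - α) * (ι (d 3) * β + ι (d 5)) * _
      + (ι (d 0) * α ^ 2 + ι (d 1) * α + ι (d 2)) * _
      + ι a * (β - α) * (ι (d 3) * α + ι (d 5)) * _ + (β - α) ^ 2 * ι a ^ 2 * ι (d 7) * _ = 0
    linear_combination (β - α) ^ 2 * hp)
  rw [Finset.card_image_of_injective _ (injective_sub_mul hα)] at key
  exact ⟨key.1, fun h7 => key.2 (by simp [e, h7])⟩

end Counting

/-! ### Quaternary quadratic forms, changes of coordinates and the rational points of the quadric -/

section QuadraticForms

variable {K : Type*} [Field K]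

/-- The quadratic form in four variables with coefficients `d`. -/
def quadPoly : (Fin 10 → K) →ₗ[K] MvPolynomial (Fin 4) K where
  toFun d := C (d 0) * X 0 ^ 2 + C (d 1) * (X 0 * X 1) + C (d 2) * X 1 ^ 2 + C (d 3) * (X 0 * X 2)
    + C (d 4) * (X 0 * X 3) + C (d 5) * (X 1 * X 2) + C (d 6) * (X 1 * X 3) + C (d 7) * X 2 ^ 2
    + C (d 8) * (X 2 * X 3) + C (d 9) * X 3 ^ 2
  map_add' d d' := by
    simp only [Pi.add_apply, map_add]
    ring
  map_smul' r d := by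
    simp only [Pi.smul_apply, smul_eq_mul, map_mul, smul_eq_C_mul, RingHom.id_apply]
    ring

theorem eval_quadPoly (d : Fin 10 → K) (v : Fin 4 → K) : eval v (quadPoly d) = quadVal d v := by
  simp [quadPoly, quadVal]

theorem quadPoly_apply (d : Fin 10 → K) : quadPoly d = C (d 0) * X 0 ^ 2 + C (d 1) * (X 0 * X 1)
    + C (d 2) * X 1 ^ 2 + C (d 3) * (X 0 * X 2) + C (d 4) * (X 0 * X 3) + C (d 5) * (X 1 * X 2)
    + C (d 6) * (X 1 * X 3) + C (d 7) * X 2 ^ 2 + C (d 8) * (X 2 * X 3) + C (d 9) * X 3 ^ 2 := rfl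

theorem isHomogeneous_quadPoly (d : Fin 10 → K) : (quadPoly d).IsHomogeneous 2 := by
  have h : ∀ (r : K) (i j : Fin 4), (C r * (X i * X j)).IsHomogeneous 2 := fun r i j =>
    (isHomogeneous_C_mul_X r i).mul (isHomogeneous_X K j) |> fun h => by rwa [mul_assoc] at h
  rw [quadPoly_apply]
  simp only [sq]
  exact (((((((((h _ _ _).add (h _ _ _)).add (h _ _ _)).add (h _ _ _)).add (h _ _ _)).add
    (h _ _ _)).add (h _ _ _)).add (h _ _ _)).add (h _ _ _)).add (h _ _ _)

theorem exists_quadPoly_eq {G : MvPolynomial (Fin 4) K} (hG : G.IsHomogeneous 2) :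
    ∃ d, quadPoly d = G := by
  suffices h : ∀ i j : Fin 4, i ≤ j → X i * X j ∈ LinearMap.range (quadPoly (K := K)) from
    mem_of_isHomogeneous_two (S := LinearMap.range quadPoly) (fun i j => (le_total i j).elim
      (h i j) fun hji => mul_comm (X j) (X i : MvPolynomial (Fin 4) K) ▸ h j i hji) hG
  intro i j hij
  fin_cases i <;> fin_cases j <;> first | exact absurd hij (by decide) | skip
  · exact ⟨Pi.single 0 1, by simp [quadPoly_apply, sq]⟩
  · exact ⟨Pi.single 1 1, by simp [quadPoly_apply]⟩
  · exact ⟨Pi.single 3 1, by simp [quadPoly_apply]⟩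
  · exact ⟨Pi.single 4 1, by simp [quadPoly_apply]⟩
  · exact ⟨Pi.single 2 1, by simp [quadPoly_apply, sq]⟩
  · exact ⟨Pi.single 5 1, by simp [quadPoly_apply]⟩
  · exact ⟨Pi.single 6 1, by simp [quadPoly_apply]⟩
  · exact ⟨Pi.single 7 1, by simp [quadPoly_apply, sq]⟩
  · exact ⟨Pi.single 8 1, by simp [quadPoly_apply]⟩
  · exact ⟨Pi.single 9 1, by simp [quadPoly_apply, sq]⟩

theorem quadVal_smul (d : Fin 10 → K) (r : K) (v : Fin 4 → K) :
    quadVal d (r • v) = r ^ 2 * quadVal d v := by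
  simp only [quadVal, Pi.smul_apply, smul_eq_mul]
  ring

theorem eval_linearSubst (A : GL (Fin 4) K) (G : MvPolynomial (Fin 4) K) (v : Fin 4 → K) :
    eval v (linearSubst A G) = eval ((A : Matrix (Fin 4) (Fin 4) K).mulVec v) G := by
  simp only [linearSubst, eval, eval₂Hom_bind₁]
  congr 2
  funext i
  simp [Matrix.mulVec, dotProduct]

theorem linearSubst_mul (A B : GL (Fin 4) K) (G : MvPolynomial (Fin 4) K) :
    linearSubst A (linearSubst B G) = linearSubst (B * A) G := by
  simp only [linearSubst, bind₁_bind₁]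
  congr 2
  funext i
  simp only [map_sum, map_mul, bind₁_C_right, bind₁_X_right, Units.val_mul, Matrix.mul_apply,
    Finset.mul_sum, Finset.sum_mul]
  rw [Finset.sum_comm]
  simp only [mul_assoc]

theorem linearSubst_one (G : MvPolynomial (Fin 4) K) : linearSubst 1 G = G := by
  have : (fun i : Fin 4 => ∑ j, C ((1 : Matrix (Fin 4) (Fin 4) K) i j) * X j)
      = (X : Fin 4 → MvPolynomial (Fin 4) K) := by
    funext i
    simp [Matrix.one_apply]
  simp [linearSubst, this]

theorem isHomogeneous_linearSubst {G : MvPolynomial (Fin 4) K} {m : ℕ} (hG : G.IsHomogeneous m)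
    (A : GL (Fin 4) K) : (linearSubst A G).IsHomogeneous m := by
  have := hG.aeval (fun i => ∑ j, C ((A : Matrix (Fin 4) (Fin 4) K) i j) * X j) (n := 1)
    fun i => IsHomogeneous.sum _ _ _ fun j _ => isHomogeneous_C_mul_X _ _
  rwa [one_mul] at this

/-- The quadratic form with coefficients `d` in the coordinates given by the matrix `A`. -/
def quadForm (A : GL (Fin 4) K) : (Fin 10 → K) →ₗ[K] homogeneousSubmodule (Fin 4) K 2 :=
  LinearMap.codRestrict _ ((bind₁ fun i => ∑ j, C ((A : Matrix (Fin 4) (Fin 4) K) i j) *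
    X j).toLinearMap ∘ₗ quadPoly) fun d => isHomogeneous_linearSubst (isHomogeneous_quadPoly d) A

theorem coe_quadForm (A : GL (Fin 4) K) (d : Fin 10 → K) :
    (quadForm A d : MvPolynomial (Fin 4) K) = linearSubst A (quadPoly d) := rfl

/-- Every quadric can therefore be written in the coordinates in which `X` has its standard
equation. -/
theorem quadForm_surjective (A : GL (Fin 4) K) : Function.Surjective (quadForm A) := by
  rintro ⟨G, hG⟩
  obtain ⟨d, hd⟩ := exists_quadPoly_eq
    (isHomogeneous_linearSubst ((mem_homogeneousSubmodule 2 G).mp hG) A⁻¹)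
  exact ⟨d, Subtype.ext (by rw [coe_quadForm, hd, linearSubst_mul, inv_mul_cancel,
    linearSubst_one])⟩

theorem eval_quadForm (A : GL (Fin 4) K) (d : Fin 10 → K) (v : Fin 4 → K) :
    eval v (quadForm A d : MvPolynomial (Fin 4) K)
      = quadVal d ((A : Matrix (Fin 4) (Fin 4) K).mulVec v) := by
  rw [coe_quadForm, eval_linearSubst, eval_quadPoly]

theorem IsElliptic.exists_eq_quadForm {F : MvPolynomial (Fin 4) K} (hF : IsElliptic F) :
    ∃ (a b c : K) (A : GL (Fin 4) K), IsAnisotropic a b c ∧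
      F = quadForm A (ellipticCoeff a b c) := by
  obtain ⟨f, hf, hirr, A, rfl⟩ := hF
  obtain ⟨a, b, c, rfl⟩ := exists_coeff_of_isHomogeneous_two hf
  refine ⟨a, b, c, A, isAnisotropic_of_irreducible hirr, ?_⟩
  rw [coe_quadForm]
  congr 1
  simp [quadPoly, ellipticCoeff]

theorem mk_mem_rationalPoints_quadForm {A : GL (Fin 4) K} {d : Fin 10 → K} {v : Fin 4 → K}
    (hv : v ≠ 0) : Projectivization.mk K v hv ∈ rationalPoints (quadForm A d).1 ↔
      quadVal d ((A : Matrix (Fin 4) (Fin 4) K).mulVec v) = 0 := by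
  constructor
  · intro h
    rw [← eval_quadForm]
    exact h v (by rw [Projectivization.submodule_mk]; exact Submodule.mem_span_singleton_self v)
  · intro h w hw
    rw [Projectivization.submodule_mk] at hw
    obtain ⟨r, rfl⟩ := Submodule.mem_span_singleton.mp hw
    rw [eval_quadForm, Matrix.mulVec_smul, quadVal_smul, h, mul_zero]

/-- Representatives of the points of the quadric `f(x₀, x₁) + x₂ x₃ = 0`, where `f` is an
anisotropic form: the points of the affine chart `x₃ = 1` and `(0 : 0 : 1 : 0)`. -/
def pointVec (a b c : K) : Option (K × K) → Fin 4 → K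
  | none => ![0, 0, 1, 0]
  | some p => ![p.1, p.2, -binaryVal a b c p.1 p.2, 1]

theorem pointVec_ne_zero (a b c : K) (o : Option (K × K)) : pointVec a b c o ≠ 0 := by
  intro h
  cases o with
  | none => exact one_ne_zero (congrFun h 2)
  | some p => exact one_ne_zero (congrFun h 3)

theorem quadVal_ellipticCoeff_pointVec (a b c : K) (o : Option (K × K)) :
    quadVal (ellipticCoeff a b c) (pointVec a b c o) = 0 := by
  cases o with
  | none => simp [pointVec, quadVal_vecCons, ellipticCoeff]
  | some p =>
    simp only [pointVec, quadVal_vecCons, ellipticCoeff, binaryVal]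
    simp

theorem IsAnisotropic.exists_smul_pointVec {a b c : K} (h : IsAnisotropic a b c) {v : Fin 4 → K}
    (hv : v ≠ 0) (hv0 : quadVal (ellipticCoeff a b c) v = 0) :
    ∃ (o : Option (K × K)) (r : K), r • v = pointVec a b c o := by
  have hval : binaryVal a b c (v 0) (v 1) + v 2 * v 3 = 0 := by
    simpa [quadVal, ellipticCoeff, binaryVal] using hv0
  by_cases h3 : v 3 = 0
  · obtain ⟨h0, h1⟩ := h (v 0) (v 1) (by simpa [h3] using hval)
    have h2 : v 2 ≠ 0 := by
      intro h2
      apply hv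
      funext i
      fin_cases i <;> simp [*]
    refine ⟨none, (v 2)⁻¹, ?_⟩
    funext i
    fin_cases i <;> simp [pointVec, *]
  · refine ⟨some (v 0 / v 3, v 1 / v 3), (v 3)⁻¹, ?_⟩
    funext i
    fin_cases i
    · simp [pointVec]; field_simp
    · simp [pointVec]; field_simp
    · simp [pointVec]
      have : v 2 = - binaryVal a b c (v 0) (v 1) / v 3 := by
        rw [eq_div_iff h3]
        linear_combination hval
      rw [this]
      simp only [binaryVal]
      field_simp
    · simp [pointVec, h3]

theorem mulVec_inv_mulVec (A : GL (Fin 4) K) (v : Fin 4 → K) :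
    (A : Matrix (Fin 4) (Fin 4) K).mulVec
      (((A⁻¹ : GL (Fin 4) K) : Matrix (Fin 4) (Fin 4) K).mulVec v) = v := by
  rw [Matrix.mulVec_mulVec, ← Units.val_mul, mul_inv_cancel, Units.val_one, Matrix.one_mulVec]

theorem inv_mulVec_mulVec (A : GL (Fin 4) K) (v : Fin 4 → K) :
    ((A⁻¹ : GL (Fin 4) K) : Matrix (Fin 4) (Fin 4) K).mulVec
      ((A : Matrix (Fin 4) (Fin 4) K).mulVec v) = v := by
  rw [Matrix.mulVec_mulVec, ← Units.val_mul, inv_mul_cancel, Units.val_one, Matrix.one_mulVec]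

theorem inv_mulVec_pointVec_ne_zero (A : GL (Fin 4) K) (a b c : K) (o : Option (K × K)) :
    ((A⁻¹ : GL (Fin 4) K) : Matrix (Fin 4) (Fin 4) K).mulVec (pointVec a b c o) ≠ 0 := by
  intro h
  apply pointVec_ne_zero a b c o
  rw [← mulVec_inv_mulVec A (pointVec a b c o), h, Matrix.mulVec_zero]

/-- The rational point of an elliptic quadric with the given parameters. -/
def quadricPoint (A : GL (Fin 4) K) (a b c : K) (o : Option (K × K)) :
    rationalPoints (quadForm A (ellipticCoeff a b c)).1 :=
  ⟨Projectivization.mk K _ (inv_mulVec_pointVec_ne_zero A a b c o), by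
    rw [mk_mem_rationalPoints_quadForm, mulVec_inv_mulVec, quadVal_ellipticCoeff_pointVec]⟩

theorem quadricPoint_mem_rationalPoints {A : GL (Fin 4) K} {a b c : K} {o : Option (K × K)}
    {d : Fin 10 → K} : (quadricPoint A a b c o).1 ∈ rationalPoints (quadForm A d).1 ↔
      quadVal d (pointVec a b c o) = 0 := by
  rw [quadricPoint, mk_mem_rationalPoints_quadForm, mulVec_inv_mulVec]

theorem IsAnisotropic.quadricPoint_bijective {a b c : K} (h : IsAnisotropic a b c)
    (A : GL (Fin 4) K) : Function.Bijective (quadricPoint A a b c) := by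
  constructor
  · intro o o' ho
    obtain ⟨r, hr⟩ := (Projectivization.mk_eq_mk_iff' _ _ _ _ _).mp (congrArg Subtype.val ho)
    rw [← Matrix.mulVec_smul] at hr
    have hr' := congrArg (A : Matrix (Fin 4) (Fin 4) K).mulVec hr
    rw [mulVec_inv_mulVec, mulVec_inv_mulVec] at hr'
    have e0 := congrFun hr' 0
    have e1 := congrFun hr' 1
    have e2 := congrFun hr' 2
    have e3 := congrFun hr' 3
    rcases o with _ | ⟨x, y⟩ <;> rcases o' with _ | ⟨x', y'⟩ <;> simp [pointVec] at e0 e1 e2 e3 ⊢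
    · simp [e3] at e2
    · subst e3
      simp at e0 e1
      exact ⟨e0.symm, e1.symm⟩
  · rintro ⟨P, hP⟩
    induction P using Projectivization.ind with
    | h v hv =>
      rw [mk_mem_rationalPoints_quadForm] at hP
      have hAv : (A : Matrix (Fin 4) (Fin 4) K).mulVec v ≠ 0 := by
        intro h0
        apply hv
        rw [← inv_mulVec_mulVec A v, h0, Matrix.mulVec_zero]
      obtain ⟨o, r, hr⟩ := h.exists_smul_pointVec hAv hP
      refine ⟨o, Subtype.ext ((Projectivization.mk_eq_mk_iff' _ _ _ _ _).mpr ⟨r, ?_⟩)⟩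
      rw [← hr, Matrix.mulVec_smul, inv_mulVec_mulVec]

end QuadraticForms

/-! ### Intersection numbers and the parameters of the code -/

section Code

variable {K : Type*} [Field K]

open Classical in
-- The form takes the value `d 7` at `(0 : 0 : 1 : 0)`, whence the first summand.
theorem IsAnisotropic.ncard_inter [Fintype K] {a b c : K} (h : IsAnisotropic a b c)
    (A : GL (Fin 4) K) (d : Fin 10 → K) :
    (rationalPoints (quadForm A (ellipticCoeff a b c)).1 ∩ rationalPoints (quadForm A d).1).ncard
      = (if d 7 = 0 then 1 else 0) + (Finset.univ.filter fun p : K × K =>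
        quadVal d ![p.1, p.2, -binaryVal a b c p.1 p.2, 1] = 0).card := by
  have himage : rationalPoints (quadForm A (ellipticCoeff a b c)).1 ∩
      rationalPoints (quadForm A d).1 = (fun o => (quadricPoint A a b c o).1) ''
        {o : Option (K × K) | quadVal d (pointVec a b c o) = 0} := by
    ext P
    constructor
    · rintro ⟨hP, hP'⟩
      obtain ⟨o, ho⟩ := (h.quadricPoint_bijective A).2 ⟨P, hP⟩
      obtain rfl : (quadricPoint A a b c o).1 = P := congrArg Subtype.val ho
      exact ⟨o, quadricPoint_mem_rationalPoints.mp hP', rfl⟩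
    · rintro ⟨o, ho, rfl⟩
      exact ⟨(quadricPoint A a b c o).2, quadricPoint_mem_rationalPoints.mpr ho⟩
  rw [himage, Set.ncard_image_of_injective (f := fun o => (quadricPoint A a b c o).1) _
    (Subtype.val_injective.comp (h.quadricPoint_bijective A).1), Set.ncard_eq_toFinset_card',
    Set.toFinset_ofPred, Finset.card_filter, Fintype.sum_option, Finset.card_filter]
  congr 1
  simp [pointVec, quadVal_vecCons]

theorem IsAnisotropic.card_rationalPoints [Fintype K] {a b c : K} (h : IsAnisotropic a b c)
    (A : GL (Fin 4) K) :
    Nat.card (rationalPoints (quadForm A (ellipticCoeff a b c)).1) = Fintype.card K ^ 2 + 1 := by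
  rw [← Nat.card_eq_of_bijective _ (h.quadricPoint_bijective A), Nat.card_eq_fintype_card,
    Fintype.card_option, Fintype.card_prod, sq]

theorem IsAnisotropic.ncard_inter_le [Fintype K] (hq : 3 ≤ Fintype.card K) {a b c : K}
    (h : IsAnisotropic a b c) (A : GL (Fin 4) K) {d : Fin 10 → K}
    (hd : d ≠ d 8 • ellipticCoeff a b c) :
    (rationalPoints (quadForm A (ellipticCoeff a b c)).1 ∩ rationalPoints (quadForm A d).1).ncard
      ≤ 2 * Fintype.card K + 2 := by
  classical
  rw [h.ncard_inter]
  obtain ⟨h1, h2⟩ := h.card_zeros_le hq hd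
  split_ifs with h7
  · have := h2 h7
    omega
  · omega

/-- Two conics cut out by planes that do not meet on the quadric. -/
theorem IsAnisotropic.exists_ncard_inter_eq [Fintype K] (hq : 3 ≤ Fintype.card K) {a b c : K}
    (h : IsAnisotropic a b c) (A : GL (Fin 4) K) :
    ∃ d : Fin 10 → K, d ≠ d 8 • ellipticCoeff a b c ∧
      (rationalPoints (quadForm A (ellipticCoeff a b c)).1 ∩
        rationalPoints (quadForm A d).1).ncard = 2 * Fintype.card K + 2 := by
  classical
  obtain ⟨s, hs, t, ht, hst⟩ : ∃ s : K, s ≠ 0 ∧ ∃ t : K, t ≠ 0 ∧ s ≠ t := by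
    obtain ⟨s, t, hs, ht, hst⟩ := (Finset.one_lt_card_iff (s := Finset.univ.erase (0 : K))).mp (by
      rw [Finset.card_erase_of_mem (Finset.mem_univ _), Finset.card_univ]
      omega)
    exact ⟨s, (Finset.mem_erase.mp hs).1, t, (Finset.mem_erase.mp ht).1, hst⟩
  -- The pair of planes `(x₂ + s x₃) (x₂ + t x₃) = 0`, which reads `(f - s) (f - t) = 0` on the
  -- chart and misses the point at infinity.
  let d : Fin 10 → K := ![0, 0, 0, 0, 0, 0, 0, 1, s + t, s * t]
  refine ⟨d, fun hd => ?_, ?_⟩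
  · have := congrFun hd 7
    simp [d, ellipticCoeff] at this
  · rw [h.ncard_inter, if_neg (by simp [d])]
    have hfilter : (Finset.univ.filter fun p : K × K =>
        quadVal d ![p.1, p.2, -binaryVal a b c p.1 p.2, 1] = 0)
        = (Finset.univ.filter fun p : K × K => binaryVal a b c p.1 p.2 = s) ∪
          (Finset.univ.filter fun p : K × K => binaryVal a b c p.1 p.2 = t) := by
      rw [← Finset.filter_or]
      refine Finset.filter_congr fun p _ => ?_
      have : quadVal d ![p.1, p.2, -binaryVal a b c p.1 p.2, 1]
          = (binaryVal a b c p.1 p.2 - s) * (binaryVal a b c p.1 p.2 - t) := by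
        rw [quadVal_vecCons]
        simp [d]
        ring
      rw [this, mul_eq_zero, sub_eq_zero, sub_eq_zero]
    rw [hfilter, Finset.card_union_of_disjoint, h.card_fiber hs, h.card_fiber ht]
    · ring
    · exact Finset.disjoint_filter.mpr fun p _ hps hpt => hst (hps.symm.trans hpt)

theorem mem_rationalPoints_quadForm_iff {A : GL (Fin 4) K} {d : Fin 10 → K}
    {P : ℙ K (Fin 4 → K)} :
    P ∈ rationalPoints (quadForm A d).1 ↔ eval P.rep (quadForm A d).1 = 0 := by
  rw [eval_quadForm, ← mk_mem_rationalPoints_quadForm P.rep_nonzero, Projectivization.mk_rep]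

theorem functionalCode_eq_range (F : MvPolynomial (Fin 4) K) (m : ℕ)
    (l : rationalPoints F → Kˣ) : functionalCode F m l = LinearMap.range (evalForms F m l) :=
  Submodule.range_liftQ _ _ _

open Classical in
-- Two codewords agree exactly at the points where the difference of the forms vanishes, since the
-- scalars `l P` are nonzero.
theorem hammingDist_evalForms [Fintype K] (A : GL (Fin 4) K) (e d d' : Fin 10 → K)
    (l : rationalPoints (quadForm A e).1 → Kˣ) :
    hammingDist (evalForms _ 2 l (quadForm A d)) (evalForms _ 2 l (quadForm A d'))
      + (rationalPoints (quadForm A e).1 ∩ rationalPoints (quadForm A (d - d')).1).ncard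
      = Nat.card (rationalPoints (quadForm A e).1) := by
  have hinter : (rationalPoints (quadForm A e).1 ∩ rationalPoints (quadForm A (d - d')).1).ncard
      = (Finset.univ.filter fun P => evalForms _ 2 l (quadForm A d) P
        = evalForms _ 2 l (quadForm A d') P).card := by
    rw [← Subtype.image_preimage_coe, Set.ncard_image_of_injective _ Subtype.val_injective,
      Set.ncard_eq_toFinset_card']
    congr 1
    ext P
    rw [Set.mem_toFinset, Set.mem_preimage, mem_rationalPoints_quadForm_iff, Finset.mem_filter,
      map_sub]
    simp [evalForms, sub_eq_zero]
  rw [hinter, Nat.card_eq_fintype_card, hammingDist, add_comm]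
  exact Finset.card_filter_add_card_filter_not _

theorem evalForms_quadForm_eq_zero_iff [Fintype K] (hq : 3 ≤ Fintype.card K) {a b c : K}
    (h : IsAnisotropic a b c) (A : GL (Fin 4) K)
    (l : rationalPoints (quadForm A (ellipticCoeff a b c)).1 → Kˣ) (d : Fin 10 → K) :
    evalForms _ 2 l (quadForm A d) = 0 ↔ d = d 8 • ellipticCoeff a b c := by
  classical
  constructor
  · intro h0
    by_contra hd
    have h1 := hammingDist_evalForms A (ellipticCoeff a b c) d 0 l
    have h2 := h.ncard_inter_le hq A hd
    rw [map_zero, map_zero, h0, hammingDist_self, sub_zero, h.card_rationalPoints] at h1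
    -- A nonmultiple would vanish at all `q ^ 2 + 1` points, but `q ^ 2 + 1 > 2 * q + 2` for `q ≥
    -- 3`.
    nlinarith
  · intro hd
    funext P
    have hP := mem_rationalPoints_quadForm_iff.mp P.2
    rw [hd, map_smul, map_smul]
    simp [evalForms, hP]

theorem IsAnisotropic.finrank_functionalCode [Fintype K] (hq : 3 ≤ Fintype.card K) {a b c : K}
    (h : IsAnisotropic a b c) (A : GL (Fin 4) K)
    (l : rationalPoints (quadForm A (ellipticCoeff a b c)).1 → Kˣ) :
    Module.finrank K (functionalCode (quadForm A (ellipticCoeff a b c)).1 2 l) = 9 := by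
  have hker : LinearMap.ker (evalForms _ 2 l ∘ₗ quadForm A) = K ∙ ellipticCoeff a b c := by
    ext d
    rw [LinearMap.mem_ker, LinearMap.comp_apply, evalForms_quadForm_eq_zero_iff hq h,
      Submodule.mem_span_singleton]
    constructor
    · intro hd
      exact ⟨d 8, hd.symm⟩
    · rintro ⟨r, rfl⟩
      simp [ellipticCoeff]
  have hrange : LinearMap.range (evalForms _ 2 l ∘ₗ quadForm A)
      = functionalCode (quadForm A (ellipticCoeff a b c)).1 2 l := by
    rw [functionalCode_eq_range, LinearMap.range_comp_of_range_eq_top]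
    exact LinearMap.range_eq_top.mpr (quadForm_surjective A)
  have hne : ellipticCoeff a b c ≠ 0 := fun h0 => one_ne_zero (congrFun h0 8)
  have := LinearMap.finrank_range_add_finrank_ker (evalForms _ 2 l ∘ₗ quadForm A)
  rw [hker, hrange, finrank_span_singleton hne, Module.finrank_fin_fun] at this
  omega

theorem span_quadForm_eq_of_eq_smul (A : GL (Fin 4) K) {a b c : K} {d : Fin 10 → K}
    (hd : d = d 8 • ellipticCoeff a b c) (h0 : (quadForm A d).1 ≠ 0) :
    Ideal.span {(quadForm A d).1} = Ideal.span {(quadForm A (ellipticCoeff a b c)).1} := by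
  have h8 : d 8 ≠ 0 := by
    intro h8
    apply h0
    rw [hd, h8, zero_smul, map_zero]
    rfl
  rw [hd, map_smul, Submodule.coe_smul, smul_eq_C_mul, mul_comm]
  exact Ideal.span_singleton_mul_right_unit ((isUnit_iff_ne_zero.mpr h8).map C) _

/-- A form in the ideal of `X` evaluates to zero at every rational point, so it would be a scalar
multiple of the equation. -/
theorem span_quadForm_ne_of_ne_smul [Fintype K] (hq : 3 ≤ Fintype.card K) {a b c : K}
    (h : IsAnisotropic a b c) (A : GL (Fin 4) K) {d : Fin 10 → K}
    (hd : d ≠ d 8 • ellipticCoeff a b c) :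
    Ideal.span {(quadForm A d).1} ≠ Ideal.span {(quadForm A (ellipticCoeff a b c)).1} := by
  intro hspan
  apply hd
  rw [← evalForms_quadForm_eq_zero_iff hq h A 1]
  apply vanishingForms_le_ker
  change (quadForm A d).1 ∈ Ideal.span {(quadForm A (ellipticCoeff a b c)).1}
  rw [← hspan]
  exact Ideal.mem_span_singleton_self _

theorem IsAnisotropic.hasParameters_functionalCode [Fintype K] (hq : 3 ≤ Fintype.card K)
    {a b c : K} (h : IsAnisotropic a b c) (A : GL (Fin 4) K)
    (l : rationalPoints (quadForm A (ellipticCoeff a b c)).1 → Kˣ) :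
    HasParameters (functionalCode (quadForm A (ellipticCoeff a b c)).1 2 l)
      (Fintype.card K ^ 2 + 1) 9 (Fintype.card K ^ 2 - 2 * Fintype.card K - 1) := by
  have hcard := h.card_rationalPoints A
  refine ⟨by rw [← hcard, Nat.card_eq_fintype_card], h.finrank_functionalCode hq A l, ?_, ?_⟩
  · obtain ⟨d, hd, hcount⟩ := h.exists_ncard_inter_eq hq A
    rw [functionalCode_eq_range]
    refine ⟨_, ⟨quadForm A d, rfl⟩, _, ⟨quadForm A 0, rfl⟩, ?_, ?_⟩
    · rw [map_zero, map_zero]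
      exact fun h0 => hd ((evalForms_quadForm_eq_zero_iff hq h A l d).mp h0)
    · have := hammingDist_evalForms A (ellipticCoeff a b c) d 0 l
      rw [sub_zero, hcount, hcard] at this
      omega
  · rintro n ⟨x, hx, y, hy, hxy, rfl⟩
    rw [functionalCode_eq_range] at hx hy
    obtain ⟨s, rfl⟩ := hx
    obtain ⟨t, rfl⟩ := hy
    obtain ⟨d, rfl⟩ := quadForm_surjective A s
    obtain ⟨d', rfl⟩ := quadForm_surjective A t
    have hd : d - d' ≠ (d - d') 8 • ellipticCoeff a b c := by
      rw [Ne, ← evalForms_quadForm_eq_zero_iff hq h A l, map_sub, map_sub, sub_eq_zero]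
      exact hxy
    have h1 := hammingDist_evalForms A (ellipticCoeff a b c) d d' l
    have h2 := h.ncard_inter_le hq A hd
    rw [hcard] at h1
    omega

end Code

end EllipticQuadric

end

theorem mainTheorem4 {K : Type*} [Field K] [Finite K] (q : ℕ) (hq : Nat.card K = q)
    (F : MvPolynomial (Fin 4) K) (hF : EllipticQuadric.IsElliptic F) :
    (∀ G : MvPolynomial (Fin 4) K, EllipticQuadric.IsQuadricForm G →
      Ideal.span {G} ≠ Ideal.span {F} →
      (EllipticQuadric.rationalPoints F ∩ EllipticQuadric.rationalPoints G).ncard ≤ 2 * q + 2) ∧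
    (3 ≤ q →
      (∃ G : MvPolynomial (Fin 4) K, EllipticQuadric.IsQuadricForm G ∧
        Ideal.span {G} ≠ Ideal.span {F} ∧
        (EllipticQuadric.rationalPoints F ∩ EllipticQuadric.rationalPoints G).ncard
          = 2 * q + 2) ∧
      ∀ l : EllipticQuadric.rationalPoints F → Kˣ,
        EllipticQuadric.HasParameters (EllipticQuadric.functionalCode F 2 l)
          (q ^ 2 + 1) 9 (q ^ 2 - 2 * q - 1)) := by
  let _ : Fintype K := Fintype.ofFinite K
  rw [Nat.card_eq_fintype_card] at hq
  subst hq
  obtain ⟨a, b, c, A, h, rfl⟩ := hF.exists_eq_quadForm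
  refine ⟨fun G hG hne => ?_, fun hq => ⟨?_, h.hasParameters_functionalCode hq A⟩⟩
  · rcases Nat.lt_or_ge (Fintype.card K) 3 with hq | hq
    -- For `q ≤ 2` the whole of `X` has `q ^ 2 + 1 ≤ 2 * q + 2` rational points.
    · have hle := Set.ncard_le_ncard (Set.inter_subset_left (s := EllipticQuadric.rationalPoints
        (EllipticQuadric.quadForm A (EllipticQuadric.ellipticCoeff a b c)).1)
        (t := EllipticQuadric.rationalPoints G))
      rw [← Nat.card_coe_set_eq, ← Nat.card_coe_set_eq, h.card_rationalPoints] at hle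
      rw [← Nat.card_coe_set_eq]
      nlinarith
    · obtain ⟨d, hd⟩ := EllipticQuadric.quadForm_surjective A
        ⟨G, (MvPolynomial.mem_homogeneousSubmodule 2 G).mpr hG.1⟩
      obtain rfl : (EllipticQuadric.quadForm A d).1 = G := congrArg Subtype.val hd
      exact h.ncard_inter_le hq A fun hd =>
        hne (EllipticQuadric.span_quadForm_eq_of_eq_smul A hd hG.2)
  · obtain ⟨d, hd, hcount⟩ := h.exists_ncard_inter_eq hq A
    have hspan := EllipticQuadric.span_quadForm_ne_of_ne_smul hq h A hd
    refine ⟨_, ⟨(EllipticQuadric.quadForm A d).2, fun h0 => hd ?_⟩, hspan, hcount⟩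
    rw [← EllipticQuadric.evalForms_quadForm_eq_zero_iff hq h A 1,
      Submodule.coe_eq_zero.mp h0, map_zero]
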